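/- Let $n$ be a natural number and let $\mathbb{S}^n$ be the space of real symmetric $n\times n$ matrices with the inner product $\langle X,Y\rangle=\operatorname{tr}(XY)$ and the induced (Frobenius) norm $\|\cdot\|$. Let $\mathbb{S}^n_+$ be the cone of positive semidefinite matrices and $\mathbb{S}^n_{++}$ its interior, the positive definite matrices. For $f:\mathbb{S}^n\to(-\infty,\infty]$ put $\operatorname{dom} f=\{X: f(X)<\infty\}$, and let $\delta$ be the indicator function of $\mathbb{S}^n_+$ ($0$ on $\mathbb{S}^n_+$, $\infty$ elsewhere). Let $0<\gamma_{\min}\le\gamma_{\max}$, $\gamma_{1,k},\gamma_{2,k}\in[\gamma_{\min},\gamma_{\max}]$ for $k\ge0$, and $r>1$. Assume that * $f$ is continuously differentiable on $\operatorname{int}\operatorname{dom} f$, bounded from below on $\mathbb{S}^n_+$, and lower semicontinuous; * $\mathbb{S}^n_{++}\subset\operatorname{int}\operatorname{dom} f$ and $\operatorname{dom} f\cap\mathbb{S}^n_+\subset\operatorname{int}\operatorname{dom} f$; * $\nabla f$ is locally Lipschitz continuous on $\operatorname{int}\operatorname{dom} f$. For $Y\in\mathbb{S}^n_{++}$ let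 $$D_k(X,Y)=\gamma_{1,k}\det(Y)^r\Bigl(-\log\frac{\det X}{\det Y}+\langle X,Y^{-1}\rangle-n\Bigr)+\frac{\gamma_{2,k}}{2}\|X-Y\|^2$$ if $X\in\mathbb{S}^n_{++}$, and $D_k(X,Y)=\infty$ otherwise. Put $F=f+\delta$. Let $\{X^k\}_{k\ge0}$ be an infinite sequence generated by the generalized variable distance proximal gradient method, with parameters $\beta>1$, $0<\sigma<1$, $0<p\le1$. That is, $X^0\in\mathbb{S}^n_{++}$ and $F_0=F(X^0)$, and for every $k\ge0$ the following holds. For $i=0,1,2,\dots$ one takes a trial point $$X^{k,i}\in\operatorname*{argmin}_{X\in\mathbb{S}^n}\bigl\{f(X^k)+\langle\nabla f(X^k),X-X^k\rangle+\beta^iD_k(X,X^k)+\delta(X)\bigr\};$$ $i_k$ is the smallest $i$ with $F(X^{k,i})\le F_k-\sigma\beta^iD_k(X^{k,i},X^k)$; and $X^{k+1}=X^{k,i_k}$, $F_{k+1}=p_{k+1}F(X^{k+1})+(1-p_{k+1})F_k$ for some $p_{k+1}\in[p,1]$. Then every accumulation point $X^*$ of $\{X^k\}$, whether in $\mathbb{S}^n_{++}$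 or on the boundary of $\mathbb{S}^n_+$, is an F-stationary point of the problem of minimizing $f$ over $\mathbb{S}^n_+$, that is, $F(X^*)<\infty$ and $0$ belongs to the Fréchet subdifferential of $F$ at $X^*$: $$\liminf_{Y\to X^*,\,Y\ne X^*}\frac{F(Y)-F(X^*)}{\|Y-X^*\|}\ge0.$$ -/

import Mathlib

open Filter Topology Set
open scoped InnerProductSpace

noncomputable section

namespace ProxGrad

/-! ### Extended-real-valued functions on an inner product space

A function with values in `(-∞, ∞]` is a map into `EReal` that never takes the value `⊥`. -/

/-- The effective domain `{x | φ x < ∞}`. -/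
def dom {E : Type*} (φ : E → EReal) : Set E := {x | φ x < ⊤}

open Classical in
/-- The indicator function of a set in the sense of convex analysis: `0` on `A` and `∞` off `A`. -/
def indicatorFn {E : Type*} (A : Set E) (x : E) : EReal := if x ∈ A then 0 else ⊤

/-- The set of global minimizers of `φ`. -/
def argmin {E : Type*} (φ : E → EReal) : Set E := {x | ∀ z, φ x ≤ φ z}

section InnerProduct

variable {E : Type*} [NormedAddCommGroup E] [InnerProductSpace ℝ E]

/-- The Fréchet subdifferential of `φ` at `x`: all `g` with
`liminf_{y → x, y ≠ x} (φ y - φ x - ⟪g, y - x⟫) / ‖y - x‖ ≥ 0`.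
It is meant for points `x` where `φ x` is finite. -/
def frechetSubdifferential (φ : E → EReal) (x : E) : Set E :=
  {g | 0 ≤ liminf (fun y : E => (φ y - φ x - ((⟪g, y - x⟫_ℝ : ℝ) : EReal)) / ((‖y - x‖ : ℝ) : EReal))
    (𝓝[≠] x)}

/-- `x` is an F-stationary point of the problem of minimizing `φ`. -/
def IsFStationary (φ : E → EReal) (x : E) : Prop :=
  x ∈ dom φ ∧ (0 : E) ∈ frechetSubdifferential φ x

variable [CompleteSpace E]

/-- The gradient of an extended-real-valued function, at points in the interior of its domain
where it is differentiable. -/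
def grad (f : E → EReal) : E → E := gradient fun x => (f x).toReal

/-- The objective of the proximal subproblem at the point `y` with proximal parameter `b`,
`x ↦ f y + ⟪∇f y, x - y⟫ + b D(x, y) + g x`. -/
def proxObjective (f g : E → EReal) (D : E → E → EReal) (b : ℝ) (y x : E) : EReal :=
  f y + ((⟪grad f y, x - y⟫_ℝ : ℝ) : EReal) + (b : EReal) * D x y + g x

/-- A (nonterminating) run of the generalized variable distance proximal gradient method for
minimizing `F = f + g`, with parameters `β`, `σ`, `p`.  Here

* `D k` is the distance used at iteration `k`;
* `trial k i` is the trial point `x^{k,i}`, a minimizer of the subproblem with parameter `β ^ i`;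
* `idx k` is the smallest `i` for which the trial point is accepted;
* `Fref k` is the averaged reference value `F_k`, with averaging weights `wt k = p_k`;
* `x k` is the `k`-th iterate. -/
structure IsRun (f g : E → EReal) (C : Set E) (D : ℕ → E → E → EReal) (β σ p : ℝ)
    (wt : ℕ → ℝ) (Fref : ℕ → EReal) (trial : ℕ → ℕ → E) (idx : ℕ → ℕ) (x : ℕ → E) : Prop where
  one_lt_beta : 1 < β
  sigma_pos : 0 < σ
  sigma_lt_one : σ < 1
  p_pos : 0 < p
  p_le_one : p ≤ 1
  init_mem : x 0 ∈ C ∩ dom g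
  ref_zero : Fref 0 = f (x 0) + g (x 0)
  trial_mem : ∀ k, ∀ i ≤ idx k, trial k i ∈ argmin (proxObjective f g (D k) (β ^ i) (x k))
  accept : ∀ k, f (trial k (idx k)) + g (trial k (idx k)) ≤
    Fref k - ((σ * β ^ idx k : ℝ) : EReal) * D k (trial k (idx k)) (x k)
  reject : ∀ k, ∀ i < idx k, ¬ (f (trial k i) + g (trial k i) ≤
    Fref k - ((σ * β ^ i : ℝ) : EReal) * D k (trial k i) (x k))
  weight_mem : ∀ k, wt (k + 1) ∈ Icc p 1
  step : ∀ k, x (k + 1) = trial k (idx k)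
  ref_succ : ∀ k, Fref (k + 1) =
    (wt (k + 1) : EReal) * (f (x (k + 1)) + g (x (k + 1))) + ((1 - wt (k + 1) : ℝ) : EReal) * Fref k

/-- `x` is a sequence generated by the generalized variable distance proximal gradient method. -/
def IsGeneratedSequence (f g : E → EReal) (C : Set E) (D : ℕ → E → E → EReal)
    (x : ℕ → E) : Prop :=
  ∃ (β σ p : ℝ) (wt : ℕ → ℝ) (Fref : ℕ → EReal) (trial : ℕ → ℕ → E) (idx : ℕ → ℕ),
    IsRun f g C D β σ p wt Fref trial idx x

end InnerProduct

/-! ### Symmetric matrices with the trace inner product -/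

/-- The real symmetric `n × n` matrices, as a subspace of the Euclidean space of all `n × n`
arrays.  The inner product inherited from there is `⟪X, Y⟫ = ∑ i j, X i j * Y i j = tr (X Y)`, and
the norm is the Frobenius norm. -/
def symSubmodule (n : ℕ) : Submodule ℝ (EuclideanSpace ℝ (Fin n × Fin n)) where
  carrier := {X | ∀ i j, X (i, j) = X (j, i)}
  zero_mem' := fun _ _ => rfl
  add_mem' := fun {X Y} hX hY i j => by simp [hX i j, hY i j]
  smul_mem' := fun c X hX i j => by simp [hX i j]

/-- The inner product space `𝕊ⁿ` of real symmetric `n × n` matrices. -/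
abbrev SymMat (n : ℕ) : Type := symSubmodule n

instance (n : ℕ) : CompleteSpace (SymMat n) := FiniteDimensional.complete ℝ (SymMat n)

/-- The underlying matrix. -/
def SymMat.toMatrix {n : ℕ} (X : SymMat n) : Matrix (Fin n) (Fin n) ℝ :=
  Matrix.of fun i j => X.1 (i, j)

theorem SymMat.isHermitian {n : ℕ} (X : SymMat n) : X.toMatrix.IsHermitian := by
  ext i j
  simpa [SymMat.toMatrix] using (X.2 i j).symm

theorem SymMat.inner_eq_trace {n : ℕ} (X Y : SymMat n) :
    ⟪X, Y⟫_ℝ = (X.toMatrix * Y.toMatrix).trace := by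
  simp only [Submodule.coe_inner, PiLp.inner_apply, Fintype.sum_prod_type, Matrix.trace,
    Matrix.diag, Matrix.mul_apply, SymMat.toMatrix, Matrix.of_apply]
  refine Finset.sum_congr rfl fun i _ => Finset.sum_congr rfl fun j _ => ?_
  rw [Y.2 j i]
  simp [mul_comm]

/-- The positive semidefinite cone `𝕊ⁿ₊`. -/
def psdCone (n : ℕ) : Set (SymMat n) := {X | X.toMatrix.PosSemidef}

/-- The cone `𝕊ⁿ₊₊` of positive definite matrices. -/
def pdCone (n : ℕ) : Set (SymMat n) := {X | X.toMatrix.PosDef}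

/-- The positive definite matrices form the interior of the positive semidefinite cone. -/
theorem interior_psdCone (n : ℕ) : interior (psdCone n) = pdCone n := by
  have key : ∀ (X : SymMat n) (v : Fin n → ℝ),
      star v ⬝ᵥ (X.toMatrix.mulVec v) = ∑ i, ∑ j, v i * X.1 (i, j) * v j := by
    intro X v
    simp [dotProduct, Matrix.mulVec, SymMat.toMatrix, Finset.mul_sum, mul_assoc]
  apply Subset.antisymm
  · intro X hX
    let J : SymMat n := ⟨WithLp.toLp 2 fun q => if q.1 = q.2 then 1 else 0, fun i j => by
      simp [eq_comm]⟩
    have hcont : Continuous fun t : ℝ => X - t • J := by fun_prop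
    have h0 : ∀ᶠ t in 𝓝 (0 : ℝ), X - t • J ∈ psdCone n := by
      have := hcont.continuousAt (x := 0) |>.tendsto
      simp only [zero_smul, sub_zero] at this
      exact this (mem_interior_iff_mem_nhds.1 hX)
    obtain ⟨t, ht, htpos⟩ := ((h0.filter_mono nhdsWithin_le_nhds).and
      (self_mem_nhdsWithin : Ioi (0 : ℝ) ∈ 𝓝[>] 0)).exists
    have h1 : X.toMatrix = (X - t • J).toMatrix + t • (1 : Matrix (Fin n) (Fin n) ℝ) := by
      ext i j
      simp [SymMat.toMatrix, J, Matrix.one_apply]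
    change X.toMatrix.PosDef
    rw [h1]
    exact Matrix.PosDef.posSemidef_add ht (Matrix.PosDef.one.smul htpos)
  · have hsub : pdCone n ⊆ psdCone n := fun X hX => Matrix.PosDef.posSemidef hX
    refine interior_maximal hsub ?_
    let S : Set (Fin n → ℝ) := Metric.sphere 0 1
    let G : SymMat n → (Fin n → ℝ) → ℝ := fun X v => ∑ i, ∑ j, v i * X.1 (i, j) * v j
    have hS : IsCompact S := isCompact_sphere _ _
    have hG : Continuous fun q : SymMat n × (Fin n → ℝ) => G q.1 q.2 := by
      simp only [G]; fun_prop
    have heq : pdCone n = {X | ∀ v ∈ S, 0 < G X v} := by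
      ext X
      constructor
      · intro hX v hv
        have := (Matrix.PosDef.dotProduct_mulVec_pos hX (x := v) (by
          rintro rfl; simp [S] at hv))
        rw [key] at this; exact this
      · intro h
        refine Matrix.PosDef.of_dotProduct_mulVec_pos X.isHermitian fun v hv => ?_
        rw [key]
        have hn : 0 < ‖v‖ := norm_pos_iff.2 hv
        have := h (‖v‖⁻¹ • v) (by simp [S, norm_smul, hn.ne'])
        have e : G X (‖v‖⁻¹ • v) = ‖v‖⁻¹ ^ 2 * ∑ i, ∑ j, v i * X.1 (i, j) * v j := by
          simp only [G, Finset.mul_sum, Pi.smul_apply, smul_eq_mul]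
          refine Finset.sum_congr rfl fun i _ => Finset.sum_congr rfl fun j _ => by ring
        rw [e] at this
        exact (pos_iff_pos_of_mul_pos this).1 (by positivity)
    rw [heq, isOpen_iff_mem_nhds]
    intro X hX
    have := hS.eventually_forall_of_forall_eventually (x₀ := X)
      (P := fun Y v => 0 < G Y v) (fun v hv => hG.continuousAt.eventually
        (lt_mem_nhds (hX v hv)))
    exact this

open Classical in
/-- The distance
`γ₁ det(Y)^r (-log (det X / det Y) + ⟨X, Y⁻¹⟩ - n) + (γ₂ / 2) ‖X - Y‖²`
for positive definite `X` and `Y`.  Its value is `∞` if `X` is not positive definite, in accordance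
with `-log 0 = ∞` on the boundary of the cone. -/
def pdDist {n : ℕ} (r γ₁ γ₂ : ℝ) (X Y : SymMat n) : EReal :=
  if X ∈ pdCone n then
    ((γ₁ * Y.toMatrix.det ^ r *
        (-Real.log (X.toMatrix.det / Y.toMatrix.det) + (X.toMatrix * Y.toMatrix⁻¹).trace - n)
      + γ₂ / 2 * ‖X - Y‖ ^ 2 : ℝ) : EReal)
  else ⊤

end ProxGrad

end

/-! The optimality condition of the accepted subproblem, tested against any positive semidefinite
`Z` (`variational_inequality`), is passed to the limit along a subsequence converging to `Xs`. Since
it has the form `0 ≤ ...`, the distance term need only be bounded above by a null sequence.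

That term contains inverses that blow up at the boundary, but the weight `det(X)^r` compensates: the
harmful part is `det(X)^r X⁻¹ = det(X)^(r-1) adj X`, which vanishes in the limit because `r > 1`,
while the other inverse enters with a favourable sign (`exists_tendsto_zero_upper_bound`).

Two more facts are needed. Steps tend to zero, by descent of the averaged reference values
(`averaged_descent`). The parameters `β ^ idx k` are bounded near `Xs`, since sufficiently large
parameters cannot be rejected where the gradient is Lipschitz (`IsRun.exists_ball_pow_idx_le`).
Lower semicontinuity and the domain assumption place `Xs` in the open set where this applies. -/

/-! ### Trace and determinant inequalities -/

theorem Matrix.PosSemidef.exists_isHermitian_mul_self {ι : Type*} [Fintype ι] [DecidableEq ι]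
    {A : Matrix ι ι ℝ} (hA : A.PosSemidef) : ∃ C : Matrix ι ι ℝ, C.IsHermitian ∧ C * C = A := by
  open scoped MatrixOrder in
  refine ⟨CFC.sqrt A, ?_, CFC.sqrt_mul_sqrt_self A (Matrix.nonneg_iff_posSemidef.2 hA)⟩
  exact (Matrix.nonneg_iff_posSemidef.1 (CFC.sqrt_nonneg A)).isHermitian

theorem Matrix.PosSemidef.trace_mul_nonneg {ι : Type*} [Fintype ι] [DecidableEq ι]
    {A B : Matrix ι ι ℝ} (hA : A.PosSemidef) (hB : B.PosSemidef) : 0 ≤ (A * B).trace := by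
  obtain ⟨C, hC, rfl⟩ := hA.exists_isHermitian_mul_self
  have h := (hB.mul_mul_conjTranspose_same C).trace_nonneg
  rwa [hC.eq, Matrix.mul_assoc, Matrix.trace_mul_comm, Matrix.mul_assoc, Matrix.trace_mul_comm]
    at h

/-- The Kullback–Leibler inequality `log (det A / det B) ≤ tr (A B⁻¹) - n`. -/
theorem Matrix.PosDef.log_det_div_det_le {ι : Type*} [Fintype ι] [DecidableEq ι]
    {A B : Matrix ι ι ℝ} (hA : A.PosDef) (hB : B.PosDef) :
    Real.log (A.det / B.det) ≤ (A * B⁻¹).trace - Fintype.card ι := by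
  -- With `C = B^(-1/2)`, the claim becomes `log λ ≤ λ - 1` summed over the eigenvalues of `C * A *
  -- C`.
  obtain ⟨C, hC, hCC⟩ := hB.inv.posSemidef.exists_isHermitian_mul_self
  have hdet : C.det * C.det = B.det⁻¹ := by
    rw [← Matrix.det_mul, hCC, Matrix.det_nonsing_inv, Ring.inverse_eq_inv']
  have hCu : IsUnit C := by
    rw [Matrix.isUnit_iff_isUnit_det, isUnit_iff_ne_zero]
    intro h0
    rw [h0, zero_mul] at hdet
    exact (inv_pos.2 hB.det_pos).ne hdet
  have hM : (C * A * C).PosDef := by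
    have := hA.conjTranspose_mul_mul_same (B := C) (Matrix.mulVec_injective_of_isUnit hCu)
    rwa [hC.eq] at this
  have hMdet : (C * A * C).det = A.det / B.det := by
    rw [Matrix.det_mul, Matrix.det_mul, div_eq_mul_inv, ← hdet]; ring
  have hMtr : (C * A * C).trace = (A * B⁻¹).trace := by
    rw [Matrix.mul_assoc, Matrix.trace_mul_comm, Matrix.mul_assoc, hCC]
  rw [← hMdet, ← hMtr, hM.1.det_eq_prod_eigenvalues, hM.1.trace_eq_sum_eigenvalues]
  simp only [RCLike.ofReal_real_eq_id, id_eq]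
  rw [Real.log_prod fun i _ => (hM.eigenvalues_pos i).ne']
  calc ∑ i, Real.log (hM.1.eigenvalues i) ≤ ∑ i, (hM.1.eigenvalues i - 1) :=
        Finset.sum_le_sum fun i _ => Real.log_le_sub_one_of_pos (hM.eigenvalues_pos i)
    _ = _ := by simp [Finset.sum_sub_distrib]

/-! ### The cone, the distance and the optimality condition -/

namespace ProxGrad

variable {n : ℕ}

@[simp] theorem SymMat.toMatrix_add (X Y : SymMat n) :
    (X + Y).toMatrix = X.toMatrix + Y.toMatrix := rfl

@[simp] theorem SymMat.toMatrix_sub (X Y : SymMat n) :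
    (X - Y).toMatrix = X.toMatrix - Y.toMatrix := rfl

@[simp] theorem SymMat.toMatrix_smul (c : ℝ) (X : SymMat n) :
    (c • X).toMatrix = c • X.toMatrix := rfl

@[fun_prop]
theorem SymMat.continuous_toMatrix : Continuous (SymMat.toMatrix : SymMat n → _) := by
  unfold SymMat.toMatrix
  refine continuous_matrix fun i j => ?_
  simp only [Matrix.of_apply]
  fun_prop

theorem SymMat.continuousAt_inv {X : SymMat n} (hX : X ∈ pdCone n) :
    ContinuousAt (fun W : SymMat n => W.toMatrix⁻¹) X := by
  have hd : X.toMatrix.det ≠ 0 := (Matrix.PosDef.det_pos hX).ne'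
  simp only [Matrix.inv_def, Ring.inverse_eq_inv']
  have h1 : ContinuousAt (fun W : SymMat n => W.toMatrix.det) X := by
    apply Continuous.continuousAt; fun_prop
  have h2 : ContinuousAt (fun W : SymMat n => W.toMatrix.adjugate) X :=
    (SymMat.continuous_toMatrix.matrix_adjugate).continuousAt
  exact (h1.inv₀ hd).smul h2

theorem isClosed_psdCone : IsClosed (psdCone n) := by
  have h : psdCone n = ⋂ v : Fin n → ℝ, {X | 0 ≤ star v ⬝ᵥ (X.toMatrix.mulVec v)} := by
    ext X
    simp only [mem_iInter, mem_ofPred_eq]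
    exact ⟨fun hX v => Matrix.PosSemidef.dotProduct_mulVec_nonneg hX v,
      fun h => Matrix.PosSemidef.of_dotProduct_mulVec_nonneg X.isHermitian h⟩
  rw [h]
  refine isClosed_iInter fun v => isClosed_le continuous_const ?_
  fun_prop

theorem pdCone_subset_psdCone : pdCone n ⊆ psdCone n := fun _ hX => Matrix.PosDef.posSemidef hX

theorem add_smul_sub_mem_pdCone {Y Z : SymMat n} (hY : Y ∈ pdCone n) (hZ : Z ∈ psdCone n)
    {t : ℝ} (ht0 : 0 ≤ t) (ht1 : t < 1) : Y + t • (Z - Y) ∈ pdCone n := by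
  have h : Y + t • (Z - Y) = (1 - t) • Y + t • Z := by
    rw [smul_sub, sub_smul, one_smul]; abel
  rw [h]
  exact (Matrix.PosDef.smul hY (sub_pos.2 ht1)).add_posSemidef (Matrix.PosSemidef.smul hZ ht0)

/-- The finite value of the distance `pdDist` on positive definite matrices. -/
noncomputable def pdDistReal (r γ₁ γ₂ : ℝ) (X Y : SymMat n) : ℝ :=
  γ₁ * Y.toMatrix.det ^ r *
      (-Real.log (X.toMatrix.det / Y.toMatrix.det) + (X.toMatrix * Y.toMatrix⁻¹).trace - n)
    + γ₂ / 2 * ‖X - Y‖ ^ 2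

theorem pdDist_of_mem {r γ₁ γ₂ : ℝ} {X Y : SymMat n} (hX : X ∈ pdCone n) :
    pdDist r γ₁ γ₂ X Y = (pdDistReal r γ₁ γ₂ X Y : EReal) := if_pos hX

theorem pdDist_of_notMem {r γ₁ γ₂ : ℝ} {X Y : SymMat n} (hX : X ∉ pdCone n) :
    pdDist r γ₁ γ₂ X Y = ⊤ := if_neg hX

theorem pdDistReal_self {r γ₁ γ₂ : ℝ} {X : SymMat n} (hX : X ∈ pdCone n) :
    pdDistReal r γ₁ γ₂ X X = 0 := by
  have hd : X.toMatrix.det ≠ 0 := (Matrix.PosDef.det_pos hX).ne'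
  simp [pdDistReal, hd, Matrix.mul_nonsing_inv _ (isUnit_iff_ne_zero.2 hd)]

/-- The log-determinant part is nonnegative by the Kullback–Leibler inequality. -/
theorem sq_norm_sub_le_pdDistReal {r γ₁ γ₂ : ℝ} {X Y : SymMat n} (h₁ : 0 ≤ γ₁)
    (hX : X ∈ pdCone n) (hY : Y ∈ pdCone n) :
    γ₂ / 2 * ‖X - Y‖ ^ 2 ≤ pdDistReal r γ₁ γ₂ X Y := by
  have h := Matrix.PosDef.log_det_div_det_le hX hY
  rw [Fintype.card_fin] at h
  have h2 : 0 ≤ γ₁ * Y.toMatrix.det ^ r :=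
    mul_nonneg h₁ (Real.rpow_nonneg (Matrix.PosDef.det_pos hY).le _)
  unfold pdDistReal
  nlinarith [mul_nonneg h2 (sub_nonneg.2 h)]

/-- First order optimality condition for the proximal subproblem over the positive definite
cone. -/
theorem variational_inequality {r γ₁ γ₂ b : ℝ} {G X T Z : SymMat n} (h₁ : 0 ≤ γ₁) (hb : 0 ≤ b)
    (hX : X ∈ pdCone n) (hT : T ∈ pdCone n) (hZ : Z ∈ psdCone n)
    (hmin : ∀ W ∈ pdCone n, ⟪G, T - X⟫_ℝ + b * pdDistReal r γ₁ γ₂ T X ≤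
      ⟪G, W - X⟫_ℝ + b * pdDistReal r γ₁ γ₂ W X) :
    0 ≤ ⟪G, Z - T⟫_ℝ + b * (γ₁ * X.toMatrix.det ^ r *
      (((Z - T).toMatrix * X.toMatrix⁻¹).trace - ((Z - T).toMatrix * T.toMatrix⁻¹).trace)
        + γ₂ * ⟪T - X, Z - T⟫_ℝ) := by
  set V := Z - T with hV
  set c := γ₁ * X.toMatrix.det ^ r with hc
  have hc0 : 0 ≤ c := mul_nonneg h₁ (Real.rpow_nonneg (Matrix.PosDef.det_pos hX).le _)
  have key : ∀ t ∈ Ioo (0 : ℝ) 1, 0 ≤ ⟪G, V⟫_ℝ + b * (c *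
      ((V.toMatrix * X.toMatrix⁻¹).trace - (V.toMatrix * (T + t • V).toMatrix⁻¹).trace)
        + γ₂ * ⟪T - X, V⟫_ℝ + γ₂ / 2 * t * ‖V‖ ^ 2) := by
    intro t ht
    have hW := add_smul_sub_mem_pdCone hT hZ ht.1.le ht.2
    rw [← hV] at hW
    have h := hmin _ hW
    set W := T + t • V with hWdef
    have dX := Matrix.PosDef.det_pos hX
    have dT := Matrix.PosDef.det_pos hT
    have dW := Matrix.PosDef.det_pos hW
    -- Applied to `T` relative to `W`, this bounds the change of `-log det` by its slope at `W`, so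
    -- no derivative of the determinant is needed; the slope at `T` appears as `t → 0`.
    have hlog := Matrix.PosDef.log_det_div_det_le hT hW
    have e1 : (T.toMatrix * W.toMatrix⁻¹).trace = n - t * (V.toMatrix * W.toMatrix⁻¹).trace := by
      have : T.toMatrix = W.toMatrix - t • V.toMatrix := by simp [hWdef]
      rw [this, Matrix.sub_mul, Matrix.mul_nonsing_inv _ (isUnit_iff_ne_zero.2 dW.ne')]
      simp
    have e2 : (W.toMatrix * X.toMatrix⁻¹).trace =
        (T.toMatrix * X.toMatrix⁻¹).trace + t * (V.toMatrix * X.toMatrix⁻¹).trace := by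
      simp [hWdef, Matrix.add_mul]
    have hsm : ∀ u : SymMat n, ⟪u, t • V⟫_ℝ = t * ⟪u, V⟫_ℝ := fun u => real_inner_smul_right u V t
    have e3 : ‖W - X‖ ^ 2 = ‖T - X‖ ^ 2 + 2 * t * ⟪T - X, V⟫_ℝ + t ^ 2 * ‖V‖ ^ 2 := by
      rw [show W - X = (T - X) + t • V by rw [hWdef]; abel, norm_add_sq_real, hsm,
        norm_smul, mul_pow, Real.norm_eq_abs, sq_abs]
      ring
    have e4 : ⟪G, W - X⟫_ℝ = ⟪G, T - X⟫_ℝ + t * ⟪G, V⟫_ℝ := by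
      rw [show W - X = (T - X) + t • V by rw [hWdef]; abel, inner_add_right, hsm]
    rw [Fintype.card_fin, e1, Real.log_div dT.ne' dW.ne'] at hlog
    unfold pdDistReal at h
    rw [← hc, e2, e3, e4, Real.log_div dT.ne' dX.ne', Real.log_div dW.ne' dX.ne'] at h
    have hl := mul_le_mul_of_nonneg_left hlog (mul_nonneg hb hc0)
    refine (mul_nonneg_iff_of_pos_left ht.1).1 ?_
    linarith
  have hlim : Tendsto (fun t : ℝ => ⟪G, V⟫_ℝ + b * (c *
      ((V.toMatrix * X.toMatrix⁻¹).trace - (V.toMatrix * (T + t • V).toMatrix⁻¹).trace)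
        + γ₂ * ⟪T - X, V⟫_ℝ + γ₂ / 2 * t * ‖V‖ ^ 2)) (𝓝[>] 0)
      (𝓝 (⟪G, V⟫_ℝ + b * (c *
      ((V.toMatrix * X.toMatrix⁻¹).trace - (V.toMatrix * T.toMatrix⁻¹).trace)
        + γ₂ * ⟪T - X, V⟫_ℝ + γ₂ / 2 * 0 * ‖V‖ ^ 2))) := by
    have ht : Tendsto (fun t : ℝ => t) (𝓝[>] 0) (𝓝 0) := nhdsWithin_le_nhds
    have hTV : Tendsto (fun t : ℝ => T + t • V) (𝓝[>] 0) (𝓝 T) := by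
      simpa using (ht.smul_const V).const_add T
    have hinv : Tendsto (fun t : ℝ => (V.toMatrix * (T + t • V).toMatrix⁻¹).trace) (𝓝[>] 0)
        (𝓝 (V.toMatrix * T.toMatrix⁻¹).trace) := by
      have hcont : Continuous fun M : Matrix (Fin n) (Fin n) ℝ => (V.toMatrix * M).trace := by
        fun_prop
      exact (hcont.tendsto _).comp ((SymMat.continuousAt_inv hT).tendsto.comp hTV)
    refine Tendsto.const_add _ (Tendsto.const_mul _ ((Tendsto.add_const _ ?_).add ?_))
    · exact (hinv.const_sub _).const_mul _
    · exact (ht.const_mul _).mul_const _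
  have h0 := ge_of_tendsto hlim (by
    filter_upwards [Ioo_mem_nhdsGT (zero_lt_one' ℝ)] with t ht using key t ht)
  linarith

theorem coe_toReal_of_mem_dom {E : Type*} {f : E → EReal} (hf : ∀ x, f x ≠ ⊥) {x : E} (hx : x ∈ dom f) :
    f x = ((f x).toReal : EReal) := (EReal.coe_toReal (ne_of_lt hx) (hf x)).symm

theorem indicatorFn_of_mem {E : Type*} {A : Set E} {x : E} (hx : x ∈ A) : indicatorFn A x = 0 :=
  if_pos hx

theorem indicatorFn_of_notMem {E : Type*} {A : Set E} {x : E} (hx : x ∉ A) : indicatorFn A x = ⊤ :=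
  if_neg hx

/-! ### Smooth functions and Fréchet stationarity -/

section Smooth

variable {E : Type*} [NormedAddCommGroup E] [InnerProductSpace ℝ E] [CompleteSpace E]

/-- The quadratic upper bound for functions with locally Lipschitz gradient. -/
theorem exists_ball_le_add_sq {φ : E → ℝ} {G : E → E} {U : Set E} (hU : IsOpen U)
    (hφ : ∀ x ∈ U, HasGradientAt φ (G x) x) (hG : LocallyLipschitzOn U G) {x : E} (hx : x ∈ U) :
    ∃ ρ > 0, ∃ L ≥ 0, ∃ M ≥ 0, Metric.ball x ρ ⊆ U ∧ (∀ y ∈ Metric.ball x ρ, ‖G y‖ ≤ M) ∧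
      ∀ y ∈ Metric.ball x ρ, ∀ z ∈ Metric.ball x ρ,
        φ z ≤ φ y + ⟪G y, z - y⟫_ℝ + L * ‖z - y‖ ^ 2 := by
  obtain ⟨K, t, ht, hK⟩ := hG hx
  rw [hU.nhdsWithin_eq hx] at ht
  obtain ⟨ρ, hρ, hball⟩ := Metric.mem_nhds_iff.1 (inter_mem ht (hU.mem_nhds hx))
  have hLip : ∀ y ∈ Metric.ball x ρ, ∀ z ∈ Metric.ball x ρ, ‖G y - G z‖ ≤ K * ‖y - z‖ := by
    intro y hy z hz
    simpa [dist_eq_norm] using hK.dist_le_mul y (hball hy).1 z (hball hz).1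
  refine ⟨ρ, hρ, K, K.2, ‖G x‖ + K * ρ, by positivity, fun y hy => (hball hy).2, ?_, ?_⟩
  · intro y hy
    have h1 := hLip y hy x (Metric.mem_ball_self hρ)
    have h2 : ‖y - x‖ ≤ ρ := by rw [← dist_eq_norm]; exact (Metric.mem_ball.1 hy).le
    have h3 : ‖G y‖ ≤ ‖G x‖ + ‖G y - G x‖ := norm_le_insert' _ _
    have h4 := mul_le_mul_of_nonneg_left h2 K.2
    exact h3.trans (by linarith!)
  · intro y hy z hz
    have hseg : segment ℝ y z ⊆ Metric.ball x ρ := (convex_ball x ρ).segment_subset hy hz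
    -- Mean value inequality for `φ` minus its linearization at `y`; it gives the constant `K`
    -- instead of the sharp `K / 2`, which suffices.
    have h := Convex.norm_image_sub_le_of_norm_hasFDerivWithin_le' (𝕜 := ℝ) (f := φ)
      (f' := fun w => InnerProductSpace.toDual ℝ E (G w)) (s := segment ℝ y z)
      (φ := InnerProductSpace.toDual ℝ E (G y)) (C := K * ‖z - y‖)
      (fun w hw => (hφ w (hball (hseg hw)).2).hasFDerivAt.hasFDerivWithinAt)
      (fun w hw => by
        rw [← map_sub, LinearIsometryEquiv.norm_map]
        refine (hLip w (hseg hw) y hy).trans (mul_le_mul_of_nonneg_left ?_ K.2)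
        obtain ⟨a, b, ha, hb, hab, rfl⟩ := hw
        have : a • y + b • z - y = b • (z - y) := by
          rw [eq_sub_of_add_eq hab]; module
        rw [this, norm_smul, Real.norm_of_nonneg hb]
        exact mul_le_of_le_one_left (norm_nonneg _) (by linarith))
      (convex_segment y z) (left_mem_segment ℝ y z) (right_mem_segment ℝ y z)
    have h2 := (abs_le.1 ((Real.norm_eq_abs _).symm.trans_le h)).2
    simp only [InnerProductSpace.toDual_apply_apply] at h2
    nlinarith

theorem hasGradientAt_toReal {f : E → EReal}
    (hf : ContDiffOn ℝ 1 (fun x => (f x).toReal) (interior (dom f))) {x : E}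
    (hx : x ∈ interior (dom f)) :
    HasGradientAt (fun x => (f x).toReal) (grad f x) x :=
  ((hf.differentiableOn one_ne_zero).differentiableAt
    (isOpen_interior.mem_nhds hx)).hasGradientAt

/-- The variational inequality implies Fréchet stationarity for the constrained problem. -/
theorem isFStationary_of_variational_inequality {f : E → EReal} (hf_ne_bot : ∀ x, f x ≠ ⊥)
    (hf : ContDiffOn ℝ 1 (fun x => (f x).toReal) (interior (dom f))) {A : Set E} {x : E}
    (hx : x ∈ interior (dom f)) (hxA : x ∈ A) (hvi : ∀ z ∈ A, 0 ≤ ⟪grad f x, z - x⟫_ℝ) :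
    IsFStationary (fun z => f z + indicatorFn A z) x := by
  have hxd : x ∈ dom f := interior_subset hx
  refine ⟨by simpa [dom, indicatorFn_of_mem hxA] using hxd, ?_⟩
  simp only [frechetSubdifferential, mem_ofPred_eq, inner_zero_left, EReal.coe_zero, sub_zero]
  refine le_of_forall_lt fun c hc => ?_
  obtain ⟨e, hce, he⟩ := EReal.lt_iff_exists_real_btwn.1 hc
  have he' : e < 0 := by exact_mod_cast he
  refine hce.trans_le (le_liminf_of_le (by isBoundedDefault) ?_)
  -- With tolerance `-e > 0`, the remainder is at least `e * ‖y - x‖`. Off `A` the quotient is `⊤`.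
  have hlo := (hasFDerivAt_iff_isLittleO.1 (hasGradientAt_toReal hf hx).hasFDerivAt).def
    (neg_pos.2 he')
  filter_upwards [nhdsWithin_le_nhds hlo, nhdsWithin_le_nhds (isOpen_interior.mem_nhds hx),
    self_mem_nhdsWithin] with y hy hyd hyx
  have hpos : 0 < ‖y - x‖ := norm_pos_iff.2 (sub_ne_zero.2 hyx)
  rw [indicatorFn_of_mem hxA, add_zero, coe_toReal_of_mem_dom hf_ne_bot hxd]
  by_cases hyA : y ∈ A
  · rw [indicatorFn_of_mem hyA, add_zero,
      coe_toReal_of_mem_dom hf_ne_bot (interior_subset hyd), ← EReal.coe_sub, ← EReal.coe_div,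
      EReal.coe_le_coe_iff, le_div_iff₀ hpos]
    have h1 := (abs_le.1 ((Real.norm_eq_abs _).symm.trans_le hy)).1
    simp only [InnerProductSpace.toDual_apply_apply] at h1
    linarith [hvi y hyA]
  · rw [indicatorFn_of_notMem hyA, EReal.add_top_of_ne_bot (hf_ne_bot y), EReal.top_sub_coe,
      EReal.top_div_of_pos_ne_top (by exact_mod_cast hpos) (EReal.coe_ne_top _)]
    exact le_top

end Smooth

/-! ### The distance term in the limit -/

/-- For nonsingular `A` both traces have the same limit. For singular `A`, `tr(T X⁻¹)` and `tr(Z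
T⁻¹)` are nonnegative and occur with a minus sign, so they can be dropped; no comparison of the
rates of `X` and `T` is needed. -/
theorem exists_tendsto_zero_upper_bound {r : ℝ} (hr : 1 < r) {A Z : SymMat n}
    (hA : A ∈ psdCone n) (hZ : Z ∈ psdCone n) {X T : ℕ → SymMat n} (hX : ∀ j, X j ∈ pdCone n)
    (hT : ∀ j, T j ∈ pdCone n) (hXA : Tendsto X atTop (𝓝 A)) (hTA : Tendsto T atTop (𝓝 A)) :
    ∃ u : ℕ → ℝ, Tendsto u atTop (𝓝 0) ∧ ∀ j, (X j).toMatrix.det ^ r *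
      (((Z - T j).toMatrix * (X j).toMatrix⁻¹).trace -
        ((Z - T j).toMatrix * (T j).toMatrix⁻¹).trace) ≤ u j := by
  have hmat := SymMat.continuous_toMatrix (n := n)
  have hdet : Tendsto (fun j => (X j).toMatrix.det) atTop (𝓝 A.toMatrix.det) := by
    have : Continuous fun W : SymMat n => W.toMatrix.det := by fun_prop
    exact (this.tendsto A).comp hXA
  have hdetr : ∀ {q : ℝ}, 0 < q →
      Tendsto (fun j => (X j).toMatrix.det ^ q) atTop (𝓝 (A.toMatrix.det ^ q)) := fun hq =>
    (Real.continuousAt_rpow_const _ _ (Or.inr hq.le)).tendsto.comp hdet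
  by_cases hpd : A ∈ pdCone n
  · refine ⟨_, ?_, fun j => le_rfl⟩
    have hZT : Tendsto (fun j => (Z - T j).toMatrix) atTop (𝓝 (Z - A).toMatrix) :=
      (hmat.tendsto _).comp (hTA.const_sub Z)
    have htr : ∀ {W : ℕ → SymMat n}, Tendsto W atTop (𝓝 A) →
        Tendsto (fun j => ((Z - T j).toMatrix * (W j).toMatrix⁻¹).trace) atTop
          (𝓝 ((Z - A).toMatrix * A.toMatrix⁻¹).trace) := by
      intro W hW
      have hc : Continuous fun M : Matrix (Fin n) (Fin n) ℝ => M.trace := by fun_prop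
      exact (hc.tendsto _).comp
        (hZT.mul ((SymMat.continuousAt_inv hpd).tendsto.comp hW))
    simpa using (hdetr (zero_lt_one.trans hr)).mul ((htr hXA).sub (htr hTA))
  · have hdet0 : A.toMatrix.det = 0 := by
      by_contra h
      exact hpd ((Matrix.PosSemidef.posDef_iff_det_ne_zero hA).2 h)
    -- What remains is `det(X)^r (n + tr(Z X⁻¹))`, with `X⁻¹` written through the adjugate, which
    -- stays bounded.
    refine ⟨fun j => (X j).toMatrix.det ^ r * n +
      (X j).toMatrix.det ^ (r - 1) * (Z.toMatrix * (X j).toMatrix.adjugate).trace, ?_, fun j => ?_⟩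
    · have hadj : Tendsto (fun j => (Z.toMatrix * (X j).toMatrix.adjugate).trace) atTop
          (𝓝 (Z.toMatrix * A.toMatrix.adjugate).trace) := by
        have hc : Continuous fun W : SymMat n => (Z.toMatrix * W.toMatrix.adjugate).trace :=
          (continuous_const.mul hmat.matrix_adjugate).matrix_trace
        exact (hc.tendsto A).comp hXA
      have := ((hdetr (zero_lt_one.trans hr)).mul_const (n : ℝ)).add
        ((hdetr (sub_pos.2 hr)).mul hadj)
      rw [hdet0, Real.zero_rpow (by linarith), Real.zero_rpow (by linarith)] at this
      simpa using this
    · have dX := Matrix.PosDef.det_pos (hX j)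
      have dT := Matrix.PosDef.det_pos (hT j)
      have h1 := (pdCone_subset_psdCone (hT j)).trace_mul_nonneg (hX j).inv.posSemidef
      have h2 := Matrix.PosSemidef.trace_mul_nonneg hZ (hT j).inv.posSemidef
      have e : (X j).toMatrix.det ^ (r - 1) * (Z.toMatrix * (X j).toMatrix.adjugate).trace =
          (X j).toMatrix.det ^ r * (Z.toMatrix * (X j).toMatrix⁻¹).trace := by
        rw [Real.rpow_sub_one dX.ne', Matrix.inv_def, Ring.inverse_eq_inv', Matrix.mul_smul,
          Matrix.trace_smul, smul_eq_mul]
        field_simp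
      beta_reduce
      rw [e, ← mul_add]
      refine mul_le_mul_of_nonneg_left ?_ (Real.rpow_nonneg dX.le _)
      rw [SymMat.toMatrix_sub, Matrix.sub_mul, Matrix.sub_mul,
        Matrix.mul_nonsing_inv _ (isUnit_iff_ne_zero.2 dT.ne')]
      simp only [Matrix.trace_sub, Matrix.trace_one, Fintype.card_fin]
      linarith

/-! ### Real-valued form of a run -/

variable {f : SymMat n → EReal} {r : ℝ}

theorem proxObjective_of_mem (hf : ∀ X, f X ≠ ⊥) {γ₁ γ₂ b : ℝ} {X W : SymMat n} (hX : X ∈ dom f)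
    (hW : W ∈ pdCone n) :
    proxObjective f (indicatorFn (psdCone n)) (pdDist r γ₁ γ₂) b X W =
      (((f X).toReal + ⟪grad f X, W - X⟫_ℝ + b * pdDistReal r γ₁ γ₂ W X : ℝ) : EReal) := by
  rw [proxObjective, pdDist_of_mem hW, indicatorFn_of_mem (pdCone_subset_psdCone hW), add_zero]
  nth_rewrite 1 [coe_toReal_of_mem_dom hf hX]
  norm_cast

/-- The objective is finite at `X` and `⊤` off the positive definite cone, so minimizers lie in that
cone. -/
theorem mem_argmin_proxObjective (hf : ∀ X, f X ≠ ⊥) {γ₁ γ₂ b : ℝ} (hb : 0 < b) {X T : SymMat n}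
    (hX : X ∈ dom f) (hXpd : X ∈ pdCone n)
    (hT : T ∈ argmin (proxObjective f (indicatorFn (psdCone n)) (pdDist r γ₁ γ₂) b X)) :
    T ∈ pdCone n ∧ ∀ W ∈ pdCone n,
      ⟪grad f X, T - X⟫_ℝ + b * pdDistReal r γ₁ γ₂ T X ≤
        ⟪grad f X, W - X⟫_ℝ + b * pdDistReal r γ₁ γ₂ W X := by
  have hTpd : T ∈ pdCone n := by
    by_contra hTn
    have h := hT X
    rw [proxObjective_of_mem hf hX hXpd, proxObjective, pdDist_of_notMem hTn,
      EReal.coe_mul_top_of_pos hb, coe_toReal_of_mem_dom hf hX, ← EReal.coe_add,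
      EReal.coe_add_top, EReal.top_add_of_ne_bot (by unfold indicatorFn; split_ifs <;> simp)] at h
    exact EReal.coe_ne_top _ (top_le_iff.1 h)
  refine ⟨hTpd, fun W hW => ?_⟩
  have h := hT W
  rw [proxObjective_of_mem hf hX hTpd, proxObjective_of_mem hf hX hW,
    EReal.coe_le_coe_iff] at h
  linarith

section Run

variable {γ₁ γ₂ : ℕ → ℝ} {β σ p : ℝ} {wt : ℕ → ℝ} {Fref : ℕ → EReal} {trial : ℕ → ℕ → SymMat n}
  {idx : ℕ → ℕ} {x : ℕ → SymMat n}

theorem IsRun.iterate_mem_pdCone (hrun : IsRun f (indicatorFn (psdCone n)) (pdCone n)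
      (fun k => pdDist r (γ₁ k) (γ₂ k)) β σ p wt Fref trial idx x)
    (hf : ∀ X, f X ≠ ⊥) (hdom : pdCone n ⊆ dom f) (k : ℕ) : x k ∈ pdCone n := by
  induction k with
  | zero => exact hrun.init_mem.1
  | succ k ih =>
    rw [hrun.step k]
    exact (mem_argmin_proxObjective hf (pow_pos (zero_lt_one.trans hrun.one_lt_beta) _) (hdom ih) ih
      (hrun.trial_mem k _ le_rfl)).1

theorem IsRun.trial_spec (hrun : IsRun f (indicatorFn (psdCone n)) (pdCone n)
      (fun k => pdDist r (γ₁ k) (γ₂ k)) β σ p wt Fref trial idx x)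
    (hf : ∀ X, f X ≠ ⊥) (hdom : pdCone n ⊆ dom f) {k i : ℕ} (hi : i ≤ idx k) :
    trial k i ∈ pdCone n ∧ ∀ W ∈ pdCone n,
      ⟪grad f (x k), trial k i - x k⟫_ℝ + β ^ i * pdDistReal r (γ₁ k) (γ₂ k) (trial k i) (x k) ≤
        ⟪grad f (x k), W - x k⟫_ℝ + β ^ i * pdDistReal r (γ₁ k) (γ₂ k) W (x k) :=
  mem_argmin_proxObjective hf (pow_pos (zero_lt_one.trans hrun.one_lt_beta) _)
    (hdom (hrun.iterate_mem_pdCone hf hdom k)) (hrun.iterate_mem_pdCone hf hdom k)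
    (hrun.trial_mem k i hi)

/-- All iterates and tested trial points are positive definite, hence every value in the run is
finite and extended arithmetic can be left behind. -/
theorem IsRun.exists_real_ref (hrun : IsRun f (indicatorFn (psdCone n)) (pdCone n)
      (fun k => pdDist r (γ₁ k) (γ₂ k)) β σ p wt Fref trial idx x)
    (hf : ∀ X, f X ≠ ⊥) (hdom : pdCone n ⊆ dom f) :
    ∃ R : ℕ → ℝ, R 0 = (f (x 0)).toReal ∧
      (∀ k, R (k + 1) = wt (k + 1) * (f (x (k + 1))).toReal + (1 - wt (k + 1)) * R k) ∧
      (∀ k, (f (x (k + 1))).toReal ≤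
        R k - σ * β ^ idx k * pdDistReal r (γ₁ k) (γ₂ k) (x (k + 1)) (x k)) ∧
      ∀ k, ∀ i < idx k, R k - σ * β ^ i * pdDistReal r (γ₁ k) (γ₂ k) (trial k i) (x k) <
        (f (trial k i)).toReal := by
  have hF : ∀ W ∈ pdCone n, f W + indicatorFn (psdCone n) W = ((f W).toReal : EReal) := by
    intro W hW
    rw [indicatorFn_of_mem (pdCone_subset_psdCone hW), add_zero,
      ← coe_toReal_of_mem_dom hf (hdom hW)]
  have hx := hrun.iterate_mem_pdCone hf hdom
  have hR : ∀ k, ∃ c : ℝ, Fref k = c := by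
    intro k
    induction k with
    | zero => exact ⟨_, hrun.ref_zero.trans (hF _ (hx 0))⟩
    | succ k ih =>
      obtain ⟨c, hc⟩ := ih
      refine ⟨wt (k + 1) * (f (x (k + 1))).toReal + (1 - wt (k + 1)) * c, ?_⟩
      rw [hrun.ref_succ, hF _ (hx _), hc]
      norm_cast
  choose R hR using hR
  refine ⟨R, ?_, fun k => ?_, fun k => ?_, fun k i hi => ?_⟩
  · have := hrun.ref_zero
    rw [hR, hF _ (hx 0)] at this
    exact_mod_cast this
  · have := hrun.ref_succ k
    rw [hR, hR, hF _ (hx _)] at this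
    exact_mod_cast this
  · have := hrun.accept k
    rw [← hrun.step k, hF _ (hx _), pdDist_of_mem (hx _), hR] at this
    exact_mod_cast this
  · have hT := (hrun.trial_spec hf hdom hi.le).1
    have := hrun.reject k i hi
    rw [hF _ hT, pdDist_of_mem hT, hR, not_le] at this
    exact_mod_cast this

end Run

/-! ### Averaged descent and bounded proximal parameters -/

/-- Since `R k - R (k + 1) = w (k + 1) * (R k - a (k + 1)) ≥ p * σ * e k`, the sequence `R`
decreases; being bounded below, it converges and forces `e` to zero. -/
theorem averaged_descent {a R e w : ℕ → ℝ} {p σ m : ℝ} (hp : 0 < p) (hσ : 0 < σ)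
    (h0 : R 0 = a 0) (hR : ∀ k, R (k + 1) = w (k + 1) * a (k + 1) + (1 - w (k + 1)) * R k)
    (hw : ∀ k, w (k + 1) ∈ Icc p 1) (ha : ∀ k, a (k + 1) ≤ R k - σ * e k) (he : ∀ k, 0 ≤ e k)
    (hm : ∀ k, m ≤ a k) :
    Tendsto e atTop (𝓝 0) ∧ (∀ k, a k ≤ R k) ∧ Antitone R := by
  have hle : ∀ k, a k ≤ R k := by
    intro k
    cases k with
    | zero => exact h0.ge
    | succ k =>
      have h1 := mul_nonneg (sub_nonneg.2 (hw k).2)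
        (by linarith [ha k, mul_nonneg hσ.le (he k)] : 0 ≤ R k - a (k + 1))
      linarith [hR k]
  have hdec : ∀ k, p * σ * e k ≤ R k - R (k + 1) := by
    intro k
    have hse := mul_nonneg hσ.le (he k)
    have h1 := mul_le_mul_of_nonneg_left (ha k) (hp.le.trans (hw k).1)
    have h2 := mul_le_mul_of_nonneg_right (hw k).1 hse
    linarith [hR k]
  have hanti : Antitone R := antitone_nat_of_succ_le fun k => by
    have := mul_nonneg (mul_nonneg hp.le hσ.le) (he k)
    linarith [hdec k]
  have hbdd : BddBelow (range R) := ⟨m, by rintro _ ⟨k, rfl⟩; exact (hm k).trans (hle k)⟩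
  have hlim := tendsto_atTop_ciInf hanti hbdd
  have hdiff : Tendsto (fun k => (R k - R (k + 1)) / (p * σ)) atTop (𝓝 0) := by
    simpa using (hlim.sub (hlim.comp (tendsto_add_atTop_nat 1))).div_const (p * σ)
  refine ⟨squeeze_zero he (fun k => ?_) hdiff, hle, hanti⟩
  rw [le_div_iff₀ (mul_pos hp hσ)]
  linarith [hdec k]

variable {γmin : ℝ} {γ₁ γ₂ : ℕ → ℝ} {β σ p : ℝ}
  {wt : ℕ → ℝ} {Fref : ℕ → EReal} {trial : ℕ → ℕ → SymMat n} {idx : ℕ → ℕ} {x : ℕ → SymMat n}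

/-- The proximal parameters stay bounded near points where the gradient is Lipschitz. -/
theorem IsRun.exists_ball_pow_idx_le (hrun : IsRun f (indicatorFn (psdCone n)) (pdCone n)
      (fun k => pdDist r (γ₁ k) (γ₂ k)) β σ p wt Fref trial idx x)
    (hf : ∀ X, f X ≠ ⊥) (hdom : pdCone n ⊆ dom f)
    (hf_C1 : ContDiffOn ℝ 1 (fun X => (f X).toReal) (interior (dom f)))
    (hf_lip : LocallyLipschitzOn (interior (dom f)) (grad f))
    (hγmin : 0 < γmin) (hγ₁ : ∀ k, γmin ≤ γ₁ k) (hγ₂ : ∀ k, γmin ≤ γ₂ k) {R : ℕ → ℝ}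
    (hle : ∀ k, (f (x k)).toReal ≤ R k)
    (hrej : ∀ k, ∀ i < idx k, R k - σ * β ^ i * pdDistReal r (γ₁ k) (γ₂ k) (trial k i) (x k) <
        (f (trial k i)).toReal)
    {Xs : SymMat n} (hXs : Xs ∈ interior (dom f)) :
    ∃ ρ > 0, ∃ B, ∀ k, x k ∈ Metric.ball Xs ρ → β ^ idx k ≤ B := by
  obtain ⟨ρ, hρ, L, hL, M, hM, -, hGM, hquad⟩ := exists_ball_le_add_sq isOpen_interior
    (fun y hy => hasGradientAt_toReal hf_C1 hy) hf_lip hXs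
  have hβ := zero_lt_one.trans hrun.one_lt_beta
  have hσ1 := sub_pos.2 hrun.sigma_lt_one
  -- Above `B₀` a trial point stays within `ρ / 2` of the iterate, so the quadratic bound applies;
  -- above `B₁` that bound then forces acceptance.
  set B₀ := 4 * M / (γmin * ρ) with hB₀
  set B₁ := 2 * L / ((1 - σ) * γmin) with hB₁
  have hB₀0 : 0 ≤ B₀ := by positivity
  have hB₁0 : 0 ≤ B₁ := by positivity
  have hbound : ∀ k, x k ∈ Metric.ball Xs (ρ / 2) → ∀ i < idx k, β ^ i ≤ B₀ + B₁ := by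
    intro k hk i hi
    by_contra! hlt
    set b := β ^ i with hb
    have hb0 : 0 < b := pow_pos hβ i
    have hxk := hrun.iterate_mem_pdCone hf hdom k
    obtain ⟨hT, hmin⟩ := hrun.trial_spec hf hdom hi.le
    have hself := hmin _ hxk
    rw [pdDistReal_self hxk, sub_self, inner_zero_right, ← hb] at hself
    have hrej' := hrej k i hi
    rw [← hb] at hrej'
    have hD := sq_norm_sub_le_pdDistReal (r := r) (γ₂ := γ₂ k) (hγmin.le.trans (hγ₁ k)) hT hxk
    set T := trial k i
    set D := pdDistReal r (γ₁ k) (γ₂ k) T (x k)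
    have hkρ : x k ∈ Metric.ball Xs ρ := Metric.ball_subset_ball (by linarith) hk
    have hin := (abs_le.1 (abs_real_inner_le_norm (grad f (x k)) (T - x k))).1
    have hd0 := norm_nonneg (T - x k)
    set d := ‖T - x k‖ with hd
    have hD' : γmin / 2 * d ^ 2 ≤ D := by nlinarith [hγ₂ k, sq_nonneg d]
    have hGd := mul_le_mul_of_nonneg_right (hGM _ hkρ) hd0
    have hbD : b * (γmin / 2 * d ^ 2) ≤ b * D := mul_le_mul_of_nonneg_left hD' hb0.le
    have hdρ : d < ρ / 2 := by
      by_contra! hge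
      have h1 : b * (γmin / 2 * d) ≤ M := by
        refine le_of_mul_le_mul_right (a := d) ?_ (by linarith)
        linarith
      have h2 : b * (γmin / 2 * (ρ / 2)) ≤ M :=
        le_trans (by gcongr) h1
      have h3 : b ≤ B₀ := by
        rw [hB₀, le_div_iff₀ (by positivity)]; linarith
      linarith
    have hTρ : T ∈ Metric.ball Xs ρ := by
      have h1 := dist_triangle T (x k) Xs
      rw [dist_eq_norm T (x k), ← hd] at h1
      exact Metric.mem_ball.2 (by linarith [Metric.mem_ball.1 hk])
    have hq := hquad _ hkρ _ hTρ
    rw [← hd] at hq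
    -- Rejection gives `f T > R k - σ b D ≥ f (x k) - σ b D`, while minimality and the quadratic
    -- bound give `f T ≤ f (x k) - b D + L d²`. Strictness also excludes `d = 0` below.
    have hlt2 : (1 - σ) * (b * D) < L * d ^ 2 := by linarith [hle k]
    have h5 := mul_le_mul_of_nonneg_left hbD hσ1.le
    have h6 : (1 - σ) * (b * (γmin / 2)) < L := by
      refine lt_of_mul_lt_mul_right (a := d ^ 2) ?_ (sq_nonneg d)
      linarith
    have h7 : b ≤ B₁ := by
      rw [hB₁, le_div_iff₀ (by positivity)]; linarith
    linarith
  -- The `1` covers `idx k = 0`; otherwise the last rejected index is `idx k - 1`, which costs a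
  -- factor `β`.
  refine ⟨ρ / 2, by positivity, 1 + β * (B₀ + B₁), fun k hk => ?_⟩
  rcases Nat.eq_zero_or_pos (idx k) with h | h
  · rw [h, pow_zero]
    linarith [mul_nonneg hβ.le (add_nonneg hB₀0 hB₁0)]
  · have h1 := hbound k hk (idx k - 1) (by omega)
    have h2 : β ^ idx k = β * β ^ (idx k - 1) := by rw [← pow_succ', Nat.sub_add_cancel h]
    rw [h2]
    linarith [mul_le_mul_of_nonneg_left h1 hβ.le]

end ProxGrad

/-! ### Passage to the limit -/

theorem mainTheorem5 (n : ℕ) (r γmin γmax : ℝ) (hr : 1 < r) (hγmin : 0 < γmin)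
    (hγ : γmin ≤ γmax) (γ₁ γ₂ : ℕ → ℝ) (hγ₁ : ∀ k, γ₁ k ∈ Set.Icc γmin γmax)
    (hγ₂ : ∀ k, γ₂ k ∈ Set.Icc γmin γmax)
    (f : ProxGrad.SymMat n → EReal) (hf_ne_bot : ∀ X, f X ≠ ⊥)
    (hf_C1 : ContDiffOn ℝ 1 (fun X => (f X).toReal) (interior (ProxGrad.dom f)))
    (hf_bdd : ∃ m : ℝ, ∀ X ∈ ProxGrad.psdCone n, (m : EReal) ≤ f X)
    (hf_lsc : LowerSemicontinuous f)
    (h_pd : ProxGrad.pdCone n ⊆ interior (ProxGrad.dom f))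
    (h_dom : ProxGrad.dom f ∩ ProxGrad.psdCone n ⊆ interior (ProxGrad.dom f))
    (hf_lip : LocallyLipschitzOn (interior (ProxGrad.dom f)) (ProxGrad.grad f))
    (X : ℕ → ProxGrad.SymMat n)
    (hX : ProxGrad.IsGeneratedSequence f (ProxGrad.indicatorFn (ProxGrad.psdCone n))
      (ProxGrad.pdCone n) (fun k => ProxGrad.pdDist r (γ₁ k) (γ₂ k)) X)
    (Xs : ProxGrad.SymMat n) (hXs : MapClusterPt Xs Filter.atTop X) :
    ProxGrad.IsFStationary (fun Z => f Z + ProxGrad.indicatorFn (ProxGrad.psdCone n) Z) Xs := by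
  open ProxGrad in
  obtain ⟨β, σ, p, wt, Fref, trial, idx, hrun⟩ := hX
  obtain ⟨m, hm⟩ := hf_bdd
  have hdom : pdCone n ⊆ dom f := h_pd.trans interior_subset
  have hXpd := hrun.iterate_mem_pdCone hf_ne_bot hdom
  have hfX : ∀ k, f (X k) = ((f (X k)).toReal : EReal) := fun k =>
    coe_toReal_of_mem_dom hf_ne_bot (hdom (hXpd k))
  obtain ⟨R, hR0, hRsucc, hacc, hrej⟩ := hrun.exists_real_ref hf_ne_bot hdom
  have hβ1 : ∀ k, 1 ≤ β ^ idx k := fun k => one_le_pow₀ hrun.one_lt_beta.le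
  have hD : ∀ k, γmin / 2 * ‖X (k + 1) - X k‖ ^ 2 ≤
      pdDistReal r (γ₁ k) (γ₂ k) (X (k + 1)) (X k) := fun k =>
    le_trans (by gcongr; exact (hγ₂ k).1) (sq_norm_sub_le_pdDistReal (r := r) (γ₂ := γ₂ k)
      (hγmin.le.trans (hγ₁ k).1) (hXpd (k + 1)) (hXpd k))
  have hD0 : ∀ k, 0 ≤ pdDistReal r (γ₁ k) (γ₂ k) (X (k + 1)) (X k) := fun k =>
    le_trans (by positivity) (hD k)
  obtain ⟨he, hle, hanti⟩ := averaged_descent (a := fun k => (f (X k)).toReal) (m := m)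
    hrun.p_pos hrun.sigma_pos hR0 hRsucc
    hrun.weight_mem (fun k => (hacc k).trans_eq (by rw [mul_assoc]))
    (fun k => mul_nonneg (zero_le_one.trans (hβ1 k)) (hD0 k))
    (fun k => by
      have := hm _ (pdCone_subset_psdCone (hXpd k))
      rw [hfX k] at this
      exact_mod_cast this)
  have hstep : Tendsto (fun k => ‖X (k + 1) - X k‖) atTop (𝓝 0) := by
    have h1 : Tendsto (fun k => ‖X (k + 1) - X k‖ ^ 2) atTop (𝓝 0) := by
      have he' := he.const_mul (2 / γmin)
      rw [mul_zero] at he'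
      refine squeeze_zero (fun k => sq_nonneg _) (fun k => ?_) he'
      have h2 := (hD k).trans (le_mul_of_one_le_left (hD0 k) (hβ1 k))
      rw [div_mul_eq_mul_div, le_div_iff₀ hγmin]
      linarith
    simpa using h1.sqrt
  have hXs_psd : Xs ∈ psdCone n :=
    isClosed_psdCone.mem_of_mapClusterPt hXs
      (Eventually.of_forall fun k => pdCone_subset_psdCone (hXpd k))
  have hXs_dom : Xs ∈ dom f := by
    -- All iterates lie in this closed sublevel set, because `f (X k) ≤ R k ≤ R 0`.
    have hcl := hf_lsc.isClosed_preimage (R 0 : EReal)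
    have hmem : Xs ∈ f ⁻¹' Iic (R 0 : EReal) := hcl.mem_of_mapClusterPt hXs
      (Eventually.of_forall fun k => by
        rw [mem_preimage, mem_Iic, hfX k, EReal.coe_le_coe_iff]
        exact (hle k).trans (hanti (Nat.zero_le k)))
    exact lt_of_le_of_lt hmem (EReal.coe_lt_top _)
  have hXs_int : Xs ∈ interior (dom f) := h_dom ⟨hXs_dom, hXs_psd⟩
  obtain ⟨ρ, hρ, B, hB⟩ := hrun.exists_ball_pow_idx_le hf_ne_bot hdom hf_C1 hf_lip hγmin
    (fun k => (hγ₁ k).1) (fun k => (hγ₂ k).1) hle hrej hXs_int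
  obtain ⟨ψ, hψ, hlim⟩ := hXs.tendsto_subseq
  have hdiff : Tendsto (fun j => X (ψ j + 1) - X (ψ j)) atTop (𝓝 0) :=
    tendsto_zero_iff_norm_tendsto_zero.2 (hstep.comp hψ.tendsto_atTop)
  have hlim' : Tendsto (fun j => X (ψ j + 1)) atTop (𝓝 Xs) := by
    simpa using hdiff.add hlim
  refine isFStationary_of_variational_inequality hf_ne_bot hf_C1 hXs_int hXs_psd fun Z hZ => ?_
  obtain ⟨u, hu, hule⟩ := exists_tendsto_zero_upper_bound hr hXs_psd hZ
    (fun j => hXpd (ψ j)) (fun j => hXpd (ψ j + 1)) hlim hlim'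
  have hgrad : Tendsto (fun j => grad f (X (ψ j))) atTop (𝓝 (grad f Xs)) :=
    (hf_lip.continuousOn.continuousAt (isOpen_interior.mem_nhds hXs_int)).tendsto.comp hlim
  have hv : Tendsto (fun j => ⟪X (ψ j + 1) - X (ψ j), Z - X (ψ j + 1)⟫_ℝ) atTop (𝓝 0) := by
    simpa using hdiff.inner (𝕜 := ℝ) (hlim'.const_sub Z)
  -- Absolute values let the varying `β ^ idx`, `γ₁` and `γ₂` be replaced by `B` and `γmax` whatever
  -- the signs of the terms.
  have hbound : Tendsto (fun j => ⟪grad f (X (ψ j)), Z - X (ψ j + 1)⟫_ℝ +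
      B * (γmax * (|u j| + |⟪X (ψ j + 1) - X (ψ j), Z - X (ψ j + 1)⟫_ℝ|))) atTop
      (𝓝 ⟪grad f Xs, Z - Xs⟫_ℝ) := by
    simpa using (hgrad.inner (𝕜 := ℝ) (hlim'.const_sub Z)).add
      (((hu.abs.add hv.abs).const_mul γmax).const_mul B)
  refine ge_of_tendsto hbound ?_
  filter_upwards [hlim (Metric.ball_mem_nhds Xs hρ)] with j hj
  have hspec := hrun.trial_spec hf_ne_bot hdom (le_refl (idx (ψ j)))
  rw [← hrun.step] at hspec
  have hvi := variational_inequality (hγmin.le.trans (hγ₁ (ψ j)).1)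
    (zero_le_one.trans (hβ1 (ψ j))) (hXpd (ψ j)) hspec.1 hZ hspec.2
  refine hvi.trans (add_le_add le_rfl ?_)
  refine (mul_le_mul_of_nonneg_left ?_ (zero_le_one.trans (hβ1 (ψ j)))).trans
    (mul_le_mul_of_nonneg_right (hB (ψ j) hj)
      (mul_nonneg (hγmin.le.trans hγ) (add_nonneg (abs_nonneg _) (abs_nonneg _))))
  rw [mul_assoc, mul_add]
  refine add_le_add ?_ ?_
  · calc _ ≤ γ₁ (ψ j) * |u j| := mul_le_mul_of_nonneg_left ((hule j).trans (le_abs_self _))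
          (hγmin.le.trans (hγ₁ _).1)
      _ ≤ _ := mul_le_mul_of_nonneg_right (hγ₁ _).2 (abs_nonneg _)
  · exact (mul_le_mul_of_nonneg_left (le_abs_self _) (hγmin.le.trans (hγ₂ _).1)).trans
      (mul_le_mul_of_nonneg_right (hγ₂ _).2 (abs_nonneg _))
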